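/- Let $L_1,L_2,\dots$ be natural numbers, let $\mathcal A=\prod_{j\ge1}\{1,\dots,L_j\}$ with its product (= Borel) $\sigma$-algebra and coordinates $X_j(a)=a_j$, and let $\mathcal X=\bigcap_{n}\sigma(X_n,X_{n+1},\dots)$ be the tail $\sigma$-algebra. Let $P$ be the set of all real vectors $\beta=(\beta_{jl})_{j\ge1,\,1\le l\le L_j}$ with $0\le\beta_{jl}\le1$ for all $j,l$ and $\sum_{l=1}^{L_j}\beta_{jl}=1$ for all $j$; for $\beta\in P$ let $\mathsf P_\beta$ be the probability measure on $\mathcal A$ under which the $X_j$ are independent with $\mathsf P_\beta(X_j=l)=\beta_{jl}$. Let $\lambda^1,\dots,\lambda^K\in P$ be linearly independent, let $Q=\{g\in\mathbb R^K : \sum_{k}g_k\lambda^k\in P\}$ (a subset of the hyperplane $\sum_k g_k=1$), with the Borel $\sigma$-algebra of its Euclidean topology, and write $\mathsf P_g=\mathsf P_{\beta(g)}$ with $\beta(g)=\sum_k g_k\lambda^k$ for $g\in Q$. Suppose that the measures $\mathsf P_g$ are pairwise orthogonal (mutually singular): $\mathsf P_{g'}\perp\mathsf P_{g''}$ for all $g',g''\in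 Q$ with $g'\ne g''$. Then for every Borel probability measure $\mu$ on $Q$ there exist a Borel set $Q_1\subseteq Q$ with $\mu(Q_1)=1$ and a family of sets $A_g\in\mathcal X$, $g\in Q_1$, such that (a) $\mathsf P_g(A_g)=1$ for every $g\in Q_1$, and (b) $A_g\cap A_{g'}=\varnothing$ for all $g,g'\in Q_1$ with $g\ne g'$. -/

import Mathlib

open MeasureTheory

namespace IndepMixture

/-- Infinite real vectors `β = (β_{jl})`, where `j` ranges over `ℕ` and `l` over the `L j` possible
values of the `j`-th variable. -/
abbrev ParamSpace (L : ℕ → ℕ) : Type := (j : ℕ) → Fin (L j) → ℝ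

/-- The space of outcomes `∏_j {1, …, L_j}`. Its (product) `σ`-algebra is generated by the
coordinates `X_j`, and it is the Borel `σ`-algebra of the product topology. -/
abbrev Outcome (L : ℕ → ℕ) : Type := (j : ℕ) → Fin (L j)

/-- The convex body of parameter vectors of independent distributions:
`0 ≤ β_{jl} ≤ 1` and `∑_l β_{jl} = 1` for all `j`. -/
def paramBody (L : ℕ → ℕ) : Set (ParamSpace L) :=
  {β | (∀ j l, 0 ≤ β j l ∧ β j l ≤ 1) ∧ ∀ j, ∑ l, β j l = 1}

/-- The distribution on the `j`-th factor that gives mass `β_{jl}` to the point `l`. -/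
noncomputable def coordLaw {L : ℕ → ℕ} (β : ParamSpace L) (j : ℕ) : Measure (Fin (L j)) :=
  ∑ l, ENNReal.ofReal (β j l) • Measure.dirac l

theorem isProbabilityMeasure_coordLaw {L : ℕ → ℕ} {β : ParamSpace L} (hβ : β ∈ paramBody L)
    (j : ℕ) : IsProbabilityMeasure (coordLaw β j) := by
  constructor
  simp only [coordLaw, Measure.coe_finsetSum, Finset.sum_apply, Measure.smul_apply,
    measure_univ, smul_eq_mul, mul_one]
  rw [← ENNReal.ofReal_sum_of_nonneg (fun l _ => (hβ.1 j l).1), hβ.2 j, ENNReal.ofReal_one]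

/-- The independent distribution on the space of outcomes with parameter vector `β`
(used for `β` in `paramBody L`): the coordinates are independent and the `j`-th
coordinate takes the value `l` with probability `β_{jl}`. -/
noncomputable def indepLaw {L : ℕ → ℕ} (β : ParamSpace L) : Measure (Outcome L) :=
  Measure.infinitePi (coordLaw β)

theorem isProbabilityMeasure_indepLaw {L : ℕ → ℕ} {β : ParamSpace L} (hβ : β ∈ paramBody L) :
    IsProbabilityMeasure (indepLaw β) := by
  haveI := isProbabilityMeasure_coordLaw hβ
  unfold indepLaw
  infer_instance

/-- The linear parametrization `β(g) = ∑_k g_k λ^k` of the span of `λ^1, …, λ^K`. -/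
def mixParam {L : ℕ → ℕ} {K : ℕ} (lam : Fin K → ParamSpace L) (g : Fin K → ℝ) : ParamSpace L :=
  ∑ k, g k • lam k

/-- The set `Q ⊆ ℝ^K` of those `g` for which `β(g)` is the parameter vector of an independent
distribution. It carries the subspace topology and its Borel `σ`-algebra. -/
def paramSet {L : ℕ → ℕ} {K : ℕ} (lam : Fin K → ParamSpace L) : Set (Fin K → ℝ) :=
  {g | mixParam lam g ∈ paramBody L}

/-- The independent distribution `P_g`, for `g` in `Q`. -/
noncomputable def law {L : ℕ → ℕ} {K : ℕ} (lam : Fin K → ParamSpace L) (g : paramSet lam) :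
    Measure (Outcome L) :=
  indepLaw (mixParam lam g)

/-- The `σ`-algebra generated by the coordinates `X_n, X_{n+1}, …`. -/
def futureSigma (L : ℕ → ℕ) (n : ℕ) : MeasurableSpace (Outcome L) :=
  ⨆ j ≥ n, MeasurableSpace.comap (fun a : Outcome L => a j) inferInstance

/-- The tail `σ`-algebra, the intersection of the `σ`-algebras generated by `X_n, X_{n+1}, …`. -/
def tailSigma (L : ℕ → ℕ) : MeasurableSpace (Outcome L) :=
  ⨅ n, futureSigma L n

end IndepMixture

/-!
The laws `P_g` can be told apart by one sequence of unbiased linear estimators of `g`, consistent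
under every `P_g` at once, so the exceptional set of parameters is empty and `Q₁ = Q` works for
every `μ`.

Write `β_{jl}(v) = ∑_k v_k λ^k_{jl}` and `w_{jl} = ∑_k λ^k_{jl}`, and consider the positive
semidefinite forms `B_n(u, v) = ∑_{j < n} ∑_l β_{jl}(u) β_{jl}(v) / w_{jl}` on `ℝ^K` (`infoForm`).
For fixed `u` the statistic `T_{n,u}(a) = ∑_{j < n} β_{j a_j}(u) / w_{j a_j}` (`estimator`) has
mean `B_n(u, g)` under `P_g`, and its variance is at most `‖g‖ B_n(u, u)`, because
`β_{jl}(g) ≤ ‖g‖ w_{jl}` in the sup norm. If `B_n(v, v) ≥ ‖v‖² / ε` for all `v`, then the vector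
`u` dual to the `i`-th coordinate, `B_n(u, ·) = (·)_i`, satisfies `‖u‖ ≤ ε` and `B_n(u, u) ≤ ε`,
so `T_{n,u}` is unbiased for `g_i` with variance at most `‖g‖ ε` (`exists_small_dual_vectors`).
Taking `ε = 2^{-m}` makes the variances summable, so the estimators converge to `g` almost surely
under `P_g`. The event `A_g` is that they converge to `g`. It is a tail event because each score
`β_{jl}(u) / w_{jl}` is at most `‖u‖ → 0`: any finite number of coordinates is negligible in the
limit.

It remains to see that `B_n(v, v) → ∞` for each `v ≠ 0`; monotonicity in `n` and compactness of the
sphere then give coercivity (`exists_infoForm_coercive`). If `∑_k v_k ≠ 0`, each `j` contributes at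
least `(∑_k v_k)² / K` by Cauchy–Schwarz. If `∑_k v_k = 0`, compare the uniform vector
`g₀ = (1/K, …, 1/K)` with `g₀ + t v`, which lies in the simplex for small `t > 0`. The sum over `j`
of the chi-square distances of the factors of the two laws is `t² K sup_n B_n(v, v)`. If it were
finite, Cauchy–Schwarz would give `P_{g₀ + t v}(C)² ≤ M P_{g₀}(C)` for cylinders `C`, and cylinders
approximate all measurable sets, so the two laws would not be mutually singular
(`not_mutuallySingular_indepLaw`).
-/

namespace IndepMixture

open Filter Topology ProbabilityTheory
open scoped symmDiff ENNReal

/-! ### A cylinder criterion against mutual singularity -/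

/-- A quadratic domination of `ν` by `μ` on a generating algebra rules out mutual singularity: a set
of `μ`-measure `0` and `ν`-measure `1` would be approximated in `μ + ν` by sets of the algebra. -/
theorem not_mutuallySingular_of_sq_le {Ω : Type*} [m : MeasurableSpace Ω] {μ ν : Measure Ω}
    [IsProbabilityMeasure μ] [IsProbabilityMeasure ν] {C : Set (Set Ω)} (hC : IsSetAlgebra C)
    (hgen : m = MeasurableSpace.generateFrom C) (M : ℝ)
    (h : ∀ t ∈ C, ν.real t ^ 2 ≤ M * μ.real t) : ¬ μ.MutuallySingular ν := by
  rintro ⟨s, hs, hμ, hν⟩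
  have hM : 0 < M := by
    have := h _ hC.univ_mem
    simp only [probReal_univ] at this
    linarith
  -- An approximation within `ε` gives `(1 - ε)² ≤ M ε`, false once `ε ≤ 1/2` and `M ε ≤ 1/8`.
  set ε : ℝ := min (1 / 2) (1 / (8 * M)) with hε
  have hε0 : 0 < ε := by positivity
  obtain ⟨t, ht, hlt⟩ := exists_measure_symmDiff_lt_of_generateFrom_isSetRing (μ := μ + ν)
    hC.isSetRing ⟨{Set.univ}, Set.countable_singleton _, by simpa using hC.univ_mem, by simp⟩ hgen
    hs (ε := ENNReal.ofReal ε) (by simpa using hε0)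
  rw [Measure.add_apply] at hlt
  have h1 : μ.real t < ε := by
    have : μ t < ENNReal.ofReal ε := by
      calc μ t ≤ μ (t ∆ s ∪ s) := measure_mono fun x hx => by
            by_cases hxs : x ∈ s
            · exact Or.inr hxs
            · exact Or.inl (Or.inl ⟨hx, hxs⟩)
        _ ≤ μ (t ∆ s) + μ s := measure_union_le _ _
        _ = μ (t ∆ s) := by rw [hμ, add_zero]
        _ < _ := lt_of_le_of_lt le_self_add hlt
    exact (ENNReal.lt_ofReal_iff_toReal_lt (measure_ne_top _ _)).1 this
  have htm : MeasurableSet t := hgen ▸ MeasurableSpace.measurableSet_generateFrom ht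
  have h2 : 1 - ν.real t < ε := by
    have : ν tᶜ < ENNReal.ofReal ε := by
      calc ν tᶜ ≤ ν (t ∆ s ∪ sᶜ) := measure_mono fun x hx => by
            by_cases hxs : x ∈ s
            · exact Or.inl (Or.inr ⟨hxs, hx⟩)
            · exact Or.inr hxs
        _ ≤ ν (t ∆ s) + ν sᶜ := measure_union_le _ _
        _ = ν (t ∆ s) := by rw [hν, add_zero]
        _ < _ := lt_of_le_of_lt le_add_self hlt
    rw [← probReal_compl_eq_one_sub htm]
    exact (ENNReal.lt_ofReal_iff_toReal_lt (measure_ne_top _ _)).1 this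
  have h3 := h t ht
  have h4 : ε ≤ 1 / 2 := min_le_left _ _
  have h5 : M * ε ≤ 1 / 8 := by
    calc M * ε ≤ M * (1 / (8 * M)) := by gcongr; exact min_le_right _ _
      _ = 1 / 8 := by field_simp
  have h6 : M * μ.real t ≤ M * ε := by gcongr
  nlinarith

variable {L : ℕ → ℕ} {K : ℕ}

theorem coordLaw_real_singleton {β : ParamSpace L} (hβ : β ∈ paramBody L) (j : ℕ) (l : Fin (L j)) :
    (coordLaw β j).real {l} = β j l := by
  simp only [coordLaw, Measure.real, Measure.coe_finsetSum, Finset.sum_apply, Measure.smul_apply,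
    smul_eq_mul, Measure.dirac_apply, Set.indicator_apply, Set.mem_singleton_iff]
  simp [(hβ.1 j l).1]

theorem integral_coordLaw {β : ParamSpace L} (hβ : β ∈ paramBody L) (j : ℕ) (f : Fin (L j) → ℝ) :
    ∫ l, f l ∂coordLaw β j = ∑ l, β j l * f l := by
  have := isProbabilityMeasure_coordLaw hβ
  rw [integral_fintype .of_finite]
  simp [coordLaw_real_singleton hβ]

theorem integral_indepLaw_coord {β : ParamSpace L} (hβ : β ∈ paramBody L) (j : ℕ)
    (f : Fin (L j) → ℝ) : ∫ a, f (a j) ∂indepLaw β = ∑ l, β j l * f l := by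
  have := isProbabilityMeasure_coordLaw hβ
  rw [← integral_coordLaw hβ, ← Measure.infinitePi_map_eval (coordLaw β) j,
    integral_map (measurable_pi_apply j).aemeasurable (by fun_prop)]
  rfl

theorem indepLaw_real_cylinder {β : ParamSpace L} (hβ : β ∈ paramBody L) (s : Finset ℕ)
    (T : Finset ((j : s) → Fin (L j))) :
    (indepLaw β).real (cylinder s (T : Set ((j : s) → Fin (L j)))) =
      ∑ x ∈ T, ∏ j : s, β j (x j) := by
  have := isProbabilityMeasure_coordLaw hβ
  rw [indepLaw, Measure.real, Measure.infinitePi_cylinder _ (Set.toFinite _).measurableSet]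
  change (Measure.pi fun j : s => coordLaw β j).real T = _
  rw [← sum_measureReal_singleton]
  refine Finset.sum_congr rfl fun x _ => ?_
  rw [Measure.real, Measure.pi_singleton, ENNReal.toReal_prod]
  exact Finset.prod_congr rfl fun j _ => coordLaw_real_singleton hβ _ _

/-- The second moment of the likelihood ratio of two distributions on a finite set is `1` plus their
chi-square distance. -/
theorem sum_sq_div_eq {β γ : ParamSpace L} (hβ : β ∈ paramBody L) (hγ : γ ∈ paramBody L)
    (hac : ∀ j l, β j l = 0 → γ j l = 0) (j : ℕ) :
    ∑ l, γ j l ^ 2 / β j l = 1 + ∑ l, (γ j l - β j l) ^ 2 / β j l := by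
  have h : ∀ l, γ j l ^ 2 / β j l = (2 * γ j l - β j l) + (γ j l - β j l) ^ 2 / β j l := by
    intro l
    by_cases h0 : β j l = 0
    · simp [h0, hac j l h0]
    · field_simp
      ring
  simp_rw [h]
  rw [Finset.sum_add_distrib, Finset.sum_sub_distrib, ← Finset.mul_sum, hβ.2, hγ.2]
  norm_num

/-- Cauchy–Schwarz for the likelihood ratio on the finitely many coordinates of a cylinder; its second
moment is a product over the coordinates, bounded by the exponential of the total chi-square
distance. -/
theorem sq_indepLaw_real_cylinder_le {β γ : ParamSpace L} (hβ : β ∈ paramBody L)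
    (hγ : γ ∈ paramBody L) (hac : ∀ j l, β j l = 0 → γ j l = 0) {S : ℝ}
    (hS : ∀ s : Finset ℕ, ∑ j ∈ s, ∑ l, (γ j l - β j l) ^ 2 / β j l ≤ S) (s : Finset ℕ)
    (T : Finset ((j : s) → Fin (L j))) :
    (indepLaw γ).real (cylinder s (T : Set ((j : s) → Fin (L j)))) ^ 2 ≤
      Real.exp S * (indepLaw β).real (cylinder s (T : Set ((j : s) → Fin (L j)))) := by
  rw [indepLaw_real_cylinder hβ, indepLaw_real_cylinder hγ]
  have hnn : ∀ x : (j : s) → Fin (L j), 0 ≤ ∏ j : s, γ j (x j) ^ 2 / β j (x j) := fun x =>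
    Finset.prod_nonneg fun j _ => div_nonneg (sq_nonneg _) (hβ.1 _ _).1
  calc (∑ x ∈ T, ∏ j : s, γ j (x j)) ^ 2
      ≤ (∑ x ∈ T, ∏ j : s, γ j (x j) ^ 2 / β j (x j)) * ∑ x ∈ T, ∏ j : s, β j (x j) := by
        refine Finset.sum_sq_le_sum_mul_sum_of_sq_le_mul _ (fun x _ => hnn x)
          (fun x _ => Finset.prod_nonneg fun j _ => (hβ.1 _ _).1) fun x _ => le_of_eq ?_
        rw [← Finset.prod_mul_distrib, ← Finset.prod_pow]
        refine Finset.prod_congr rfl fun j _ => ?_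
        by_cases h0 : β j (x j) = 0
        · simp [h0, hac _ _ h0]
        · exact (by field_simp : γ j (x j) ^ 2 = γ j (x j) ^ 2 / β j (x j) * β j (x j))
    _ ≤ Real.exp S * ∑ x ∈ T, ∏ j : s, β j (x j) := by
        refine mul_le_mul_of_nonneg_right ?_ (Finset.sum_nonneg fun x _ =>
          Finset.prod_nonneg fun j _ => (hβ.1 _ _).1)
        calc ∑ x ∈ T, ∏ j : s, γ j (x j) ^ 2 / β j (x j)
            ≤ ∑ x : (j : s) → Fin (L j), ∏ j : s, γ j (x j) ^ 2 / β j (x j) :=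
              Finset.sum_le_univ_sum_of_nonneg hnn
          _ = ∏ j : s, ∑ l, γ j l ^ 2 / β j l := by
              rw [Finset.prod_univ_sum, Fintype.piFinset_univ]
          _ ≤ ∏ j : s, Real.exp (∑ l, (γ j l - β j l) ^ 2 / β j l) := by
              refine Finset.prod_le_prod (fun j _ => Finset.sum_nonneg fun l _ =>
                div_nonneg (sq_nonneg _) (hβ.1 _ _).1) fun j _ => ?_
              rw [sum_sq_div_eq hβ hγ hac, add_comm]
              exact Real.add_one_le_exp _
          _ = Real.exp (∑ j ∈ s, ∑ l, (γ j l - β j l) ^ 2 / β j l) := by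
              rw [← Real.exp_sum]
              exact congrArg _ (Finset.sum_coe_sort s
                fun j => ∑ l, (γ j l - β j l) ^ 2 / β j l)
          _ ≤ Real.exp S := Real.exp_le_exp.2 (hS s)

/-- One half of Kakutani's dichotomy, with chi-square distances in place of Hellinger distances. -/
theorem not_mutuallySingular_indepLaw {β γ : ParamSpace L} (hβ : β ∈ paramBody L)
    (hγ : γ ∈ paramBody L) (hac : ∀ j l, β j l = 0 → γ j l = 0) {S : ℝ}
    (hS : ∀ s : Finset ℕ, ∑ j ∈ s, ∑ l, (γ j l - β j l) ^ 2 / β j l ≤ S) :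
    ¬ (indepLaw β).MutuallySingular (indepLaw γ) := by
  have := isProbabilityMeasure_indepLaw hβ
  have := isProbabilityMeasure_indepLaw hγ
  refine not_mutuallySingular_of_sq_le isSetAlgebra_measurableCylinders
    generateFrom_measurableCylinders.symm (Real.exp S) fun t ht => ?_
  obtain ⟨s, T, -, rfl⟩ := (mem_measurableCylinders t).1 ht
  have := sq_indepLaw_real_cylinder_le hβ hγ hac hS s (Set.toFinite T).toFinset
  rwa [Set.Finite.coe_toFinset] at this

/-! ### The information form -/

theorem mixParam_apply (lam : Fin K → ParamSpace L) (v : Fin K → ℝ) (j : ℕ) (l : Fin (L j)) :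
    mixParam lam v j l = ∑ k, v k * lam k j l := by
  simp [mixParam, Finset.sum_apply]

/-- Rewriting with this equation keeps the unifier from unfolding the measures. -/
theorem law_mk {lam : Fin K → ParamSpace L} {g : Fin K → ℝ} (hg : g ∈ paramSet lam) :
    law lam ⟨g, hg⟩ = indepLaw (mixParam lam g) :=
  rfl

/-- The reference weights `w_{jl} = ∑_k λ^k_{jl}`. They sum to `K` over `l`, and every `β_{jl}(v)`
vanishes where `w_{jl}` does, so that division by zero does no harm below. -/
noncomputable def weight (lam : Fin K → ParamSpace L) (j : ℕ) (l : Fin (L j)) : ℝ :=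
  ∑ k, lam k j l

/-- The linear functional `v ↦ β_{jl}(v)` on `ℝ^K`. -/
noncomputable def cellFunctional (lam : Fin K → ParamSpace L) (j : ℕ) (l : Fin (L j)) :
    (Fin K → ℝ) →ₗ[ℝ] ℝ :=
  ∑ k, lam k j l • LinearMap.proj k

theorem cellFunctional_apply (lam : Fin K → ParamSpace L) (j : ℕ) (l : Fin (L j))
    (v : Fin K → ℝ) : cellFunctional lam j l v = mixParam lam v j l := by
  simp [cellFunctional, mixParam_apply, mul_comm]

/-- The information form `B_n(u, v) = ∑_{j < n} ∑_l β_{jl}(u) β_{jl}(v) / w_{jl}` of the first `n`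
variables. Up to the factor `K`, it is the Fisher information at the uniform vector
`(1/K, …, 1/K)`. -/
noncomputable def infoForm (lam : Fin K → ParamSpace L) (n : ℕ) :
    LinearMap.BilinForm ℝ (Fin K → ℝ) :=
  ∑ j ∈ Finset.range n, ∑ l, (weight lam j l)⁻¹ •
    LinearMap.BilinForm.linMulLin (cellFunctional lam j l) (cellFunctional lam j l)

theorem infoForm_apply (lam : Fin K → ParamSpace L) (n : ℕ) (u v : Fin K → ℝ) :
    infoForm lam n u v = ∑ j ∈ Finset.range n, ∑ l,
      mixParam lam u j l * mixParam lam v j l / weight lam j l := by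
  simp only [infoForm, LinearMap.BilinForm.sum_apply, LinearMap.smul_apply,
    LinearMap.BilinForm.linMulLin_apply, cellFunctional_apply, smul_eq_mul]
  exact Finset.sum_congr rfl fun j _ => Finset.sum_congr rfl fun l _ => by ring

theorem infoForm_self (lam : Fin K → ParamSpace L) (n : ℕ) (v : Fin K → ℝ) :
    infoForm lam n v v = ∑ j ∈ Finset.range n, ∑ l,
      mixParam lam v j l ^ 2 / weight lam j l := by
  simp_rw [infoForm_apply, sq]

section

variable {lam : Fin K → ParamSpace L} (hmem : ∀ k, lam k ∈ paramBody L)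
include hmem

theorem weight_nonneg (j : ℕ) (l : Fin (L j)) : 0 ≤ weight lam j l :=
  Finset.sum_nonneg fun k _ => ((hmem k).1 j l).1

theorem sum_weight (j : ℕ) : ∑ l, weight lam j l = K := by
  simp only [weight]
  rw [Finset.sum_comm]
  simp [(hmem _).2]

theorem sum_mixParam (v : Fin K → ℝ) (j : ℕ) : ∑ l, mixParam lam v j l = ∑ k, v k := by
  simp only [mixParam_apply]
  rw [Finset.sum_comm]
  simp [← Finset.mul_sum, (hmem _).2]

theorem abs_mixParam_le (v : Fin K → ℝ) (j : ℕ) (l : Fin (L j)) :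
    |mixParam lam v j l| ≤ ‖v‖ * weight lam j l := by
  rw [mixParam_apply, weight, Finset.mul_sum]
  refine (Finset.abs_sum_le_sum_abs _ _).trans (Finset.sum_le_sum fun k _ => ?_)
  rw [abs_mul, abs_of_nonneg ((hmem k).1 j l).1]
  exact mul_le_mul_of_nonneg_right (norm_le_pi_norm v k) ((hmem k).1 j l).1

theorem mixParam_eq_zero_of_weight {j : ℕ} {l : Fin (L j)} (h : weight lam j l = 0)
    (v : Fin K → ℝ) : mixParam lam v j l = 0 := by
  have := abs_mixParam_le hmem v j l
  rw [h, mul_zero] at this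
  exact abs_nonpos_iff.1 this

theorem abs_mixParam_div_weight_le (v : Fin K → ℝ) (j : ℕ) (l : Fin (L j)) :
    |mixParam lam v j l / weight lam j l| ≤ ‖v‖ := by
  rw [abs_div, abs_of_nonneg (weight_nonneg hmem j l)]
  exact div_le_of_le_mul₀ (weight_nonneg hmem j l) (norm_nonneg v) (abs_mixParam_le hmem v j l)

theorem infoSummand_nonneg (v : Fin K → ℝ) (j : ℕ) :
    0 ≤ ∑ l, mixParam lam v j l ^ 2 / weight lam j l :=
  Finset.sum_nonneg fun l _ => div_nonneg (sq_nonneg _) (weight_nonneg hmem j l)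

theorem infoForm_self_mono (v : Fin K → ℝ) : Monotone fun n => infoForm lam n v v := by
  intro m n hmn
  simp only [infoForm_self]
  exact Finset.sum_le_sum_of_subset_of_nonneg (Finset.range_mono hmn)
    fun j _ _ => infoSummand_nonneg hmem v j

theorem mem_paramSet_of_nonneg {g : Fin K → ℝ} (h0 : ∀ k, 0 ≤ g k) (h1 : ∑ k, g k = 1) :
    g ∈ paramSet lam := by
  have hnn : ∀ j l, 0 ≤ mixParam lam g j l := fun j l => by
    rw [mixParam_apply]
    exact Finset.sum_nonneg fun k _ => mul_nonneg (h0 k) ((hmem k).1 j l).1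
  have hs : ∀ j, ∑ l, mixParam lam g j l = 1 := fun j => by rw [sum_mixParam hmem, h1]
  exact ⟨fun j l => ⟨hnn j l, hs j ▸
    Finset.single_le_sum (fun l _ => hnn j l) (Finset.mem_univ l)⟩, hs⟩

/-- Cauchy–Schwarz with the weights `w_{jl}`, whose sum over `l` is `K`. -/
theorem sq_sum_le_infoSummand (v : Fin K → ℝ) (j : ℕ) :
    (∑ k, v k) ^ 2 ≤ (∑ l, mixParam lam v j l ^ 2 / weight lam j l) * K := by
  rw [← sum_mixParam hmem v j, ← sum_weight hmem j]
  refine Finset.sum_sq_le_sum_mul_sum_of_sq_le_mul _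
    (fun l _ => div_nonneg (sq_nonneg _) (weight_nonneg hmem j l))
    (fun l _ => weight_nonneg hmem j l) fun l _ => le_of_eq ?_
  by_cases h0 : weight lam j l = 0
  · simp [h0, mixParam_eq_zero_of_weight hmem h0]
  · field_simp

theorem infoForm_unbounded_of_sum_ne_zero {v : Fin K → ℝ} (hv : ∑ k, v k ≠ 0) (b : ℝ) :
    ∃ n, b ≤ infoForm lam n v v := by
  have hK : (0 : ℝ) < K := by
    rcases Nat.eq_zero_or_pos K with rfl | h
    · simp at hv
    · exact_mod_cast h
  have hc : 0 < (∑ k, v k) ^ 2 / K := by positivity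
  obtain ⟨n, hn⟩ := Archimedean.arch b hc
  refine ⟨n, hn.trans ?_⟩
  rw [infoForm_self, ← Finset.card_range n, ← Finset.sum_const, Finset.card_range]
  exact Finset.sum_le_sum fun j _ => (div_le_iff₀ hK).2 (sq_sum_le_infoSummand hmem v j)

/-- The information form along `v` is, up to a factor, the chi-square distance between the laws at
the uniform vector and at its shift by `t v`. -/
theorem not_mutuallySingular_of_infoForm_bounded (hK : 0 < K) {t b : ℝ} {v : Fin K → ℝ}
    (hm₀ : (fun _ => (K : ℝ)⁻¹) ∈ paramSet lam)
    (hm₁ : (fun _ => (K : ℝ)⁻¹) + t • v ∈ paramSet lam) (hb : ∀ n, infoForm lam n v v ≤ b) :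
    ¬ (indepLaw (mixParam lam fun _ => (K : ℝ)⁻¹)).MutuallySingular
      (indepLaw (mixParam lam ((fun _ => (K : ℝ)⁻¹) + t • v))) := by
  have hK' : (K : ℝ) ≠ 0 := by exact_mod_cast hK.ne'
  have hw : ∀ j l, mixParam lam (fun _ => (K : ℝ)⁻¹) j l = (K : ℝ)⁻¹ * weight lam j l :=
    fun j l => by rw [mixParam_apply, weight, Finset.mul_sum]
  have hd : ∀ j l, mixParam lam ((fun _ => (K : ℝ)⁻¹) + t • v) j l =
      mixParam lam (fun _ => (K : ℝ)⁻¹) j l + t * mixParam lam v j l := fun j l => by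
    simp only [← cellFunctional_apply, map_add, map_smul, smul_eq_mul]
  have hchi : ∀ j, ∑ l, (mixParam lam ((fun _ => (K : ℝ)⁻¹) + t • v) j l -
      mixParam lam (fun _ => (K : ℝ)⁻¹) j l) ^ 2 / mixParam lam (fun _ => (K : ℝ)⁻¹) j l =
        t ^ 2 * K * ∑ l, mixParam lam v j l ^ 2 / weight lam j l := fun j => by
    rw [Finset.mul_sum]
    refine Finset.sum_congr rfl fun l _ => ?_
    rw [hd, hw, add_sub_cancel_left, mul_pow]
    rcases eq_or_ne (weight lam j l) 0 with h0 | h0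
    · simp [h0]
    · field_simp
  refine not_mutuallySingular_indepLaw hm₀ hm₁ (fun j l h => ?_) (S := t ^ 2 * K * b) fun s => ?_
  · rw [hw, mul_eq_zero] at h
    exact mixParam_eq_zero_of_weight hmem (h.resolve_left (inv_ne_zero hK')) _
  · obtain ⟨n, hn⟩ := s.exists_nat_subset_range
    rw [Finset.sum_congr rfl fun j _ => hchi j, ← Finset.mul_sum]
    refine mul_le_mul_of_nonneg_left ?_ (by positivity)
    refine le_trans ?_ (hb n)
    rw [infoForm_self]
    exact Finset.sum_le_sum_of_subset_of_nonneg hn fun j _ _ => infoSummand_nonneg hmem v j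

theorem infoForm_unbounded_of_sum_eq_zero
    (horth : ∀ g g' : paramSet lam, g ≠ g' → (law lam g).MutuallySingular (law lam g'))
    {v : Fin K → ℝ} (hv : v ≠ 0) (hsum : ∑ k, v k = 0) (b : ℝ) :
    ∃ n, b ≤ infoForm lam n v v := by
  by_contra! hb
  have hK : 0 < K := by
    rcases Nat.eq_zero_or_pos K with rfl | h
    · exact absurd (Subsingleton.elim v 0) hv
    · exact h
  have hK' : (0 : ℝ) < K := by exact_mod_cast hK
  have hv0 : 0 < ‖v‖ := norm_pos_iff.2 hv
  -- The step is short enough for the uniform point moved along `v` to stay in the simplex.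
  obtain ⟨t, ht0, ht⟩ : ∃ t : ℝ, 0 < t ∧ t * ‖v‖ = (K : ℝ)⁻¹ :=
    ⟨(K * ‖v‖)⁻¹, by positivity, by field_simp⟩
  have hs₀ : ∑ _k : Fin K, (K : ℝ)⁻¹ = 1 := by simp [hK'.ne']
  have hm₀ : (fun _ => (K : ℝ)⁻¹) ∈ paramSet lam :=
    mem_paramSet_of_nonneg hmem (fun k => by positivity) hs₀
  have hm₁ : (fun _ => (K : ℝ)⁻¹) + t • v ∈ paramSet lam := by
    refine mem_paramSet_of_nonneg hmem (fun k => ?_) ?_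
    · have h1 : -‖v‖ ≤ v k := (abs_le.1 (norm_le_pi_norm v k)).1
      have h2 : t * -‖v‖ ≤ t * v k := mul_le_mul_of_nonneg_left h1 ht0.le
      simp only [Pi.add_apply, Pi.smul_apply, smul_eq_mul]
      linarith
    · simp only [Pi.add_apply, Pi.smul_apply, smul_eq_mul]
      rw [Finset.sum_add_distrib, hs₀, ← Finset.mul_sum, hsum, mul_zero, add_zero]
  have hne : (⟨fun _ => (K : ℝ)⁻¹, hm₀⟩ : paramSet lam) ≠ ⟨(fun _ => (K : ℝ)⁻¹) + t • v, hm₁⟩ := by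
    intro h
    have h' : (fun _ => (K : ℝ)⁻¹) = (fun _ => (K : ℝ)⁻¹) + t • v := congrArg Subtype.val h
    rw [left_eq_add, smul_eq_zero] at h'
    exact h'.elim ht0.ne' hv
  have hsing := horth _ _ hne
  rw [law_mk, law_mk] at hsing
  exact not_mutuallySingular_of_infoForm_bounded hmem hK hm₀ hm₁ (fun n => (hb n).le) hsing

/-- Dini's argument: the forms increase with `n` and tend to infinity on each vector of the unit
sphere, hence uniformly on it. -/
theorem exists_infoForm_coercive
    (horth : ∀ g g' : paramSet lam, g ≠ g' → (law lam g).MutuallySingular (law lam g'))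
    (M : ℝ) : ∃ n, ∀ v : Fin K → ℝ, M * ‖v‖ ^ 2 ≤ infoForm lam n v v := by
  have hcont : ∀ n, Continuous fun v : Fin K → ℝ => infoForm lam n v v := fun n => by
    simp only [infoForm_self, mixParam_apply]
    fun_prop
  obtain ⟨n, hn⟩ := (isCompact_sphere (0 : Fin K → ℝ) 1).elim_directed_cover
    (fun n => {v | M < infoForm lam n v v}) (fun n => isOpen_lt continuous_const (hcont n))
    (fun v hv => by
      have hv0 : v ≠ 0 := by
        rintro rfl
        simp at hv
      have : ∃ n, M + 1 ≤ infoForm lam n v v := by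
        by_cases h : ∑ k, v k = 0
        · exact infoForm_unbounded_of_sum_eq_zero hmem horth hv0 h _
        · exact infoForm_unbounded_of_sum_ne_zero hmem h _
      obtain ⟨n, hn⟩ := this
      exact Set.mem_iUnion.2 ⟨n, lt_of_lt_of_le (lt_add_one M) hn⟩)
    (Monotone.directed_le fun m n hmn v hv => lt_of_lt_of_le hv (infoForm_self_mono hmem v hmn))
  refine ⟨n, fun v => ?_⟩
  rcases eq_or_ne v 0 with rfl | hv
  · simp
  have hv0 : 0 < ‖v‖ := norm_pos_iff.2 hv
  have h : M < infoForm lam n (‖v‖⁻¹ • v) (‖v‖⁻¹ • v) :=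
    hn (by simp [norm_smul, hv0.ne'])
  rw [LinearMap.BilinForm.smul_left, LinearMap.BilinForm.smul_right] at h
  calc M * ‖v‖ ^ 2 ≤ (‖v‖⁻¹ * (‖v‖⁻¹ * infoForm lam n v v)) * ‖v‖ ^ 2 := by gcongr
    _ = infoForm lam n v v := by field_simp

/-- The vectors dual to the coordinates with respect to a sufficiently coercive information form are
small, in norm and in the form itself. -/
theorem exists_small_dual_vectors
    (horth : ∀ g g' : paramSet lam, g ≠ g' → (law lam g).MutuallySingular (law lam g'))
    {ε : ℝ} (hε : 0 < ε) : ∃ n, ∃ u : Fin K → Fin K → ℝ, ∀ i,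
      (∀ g, infoForm lam n (u i) g = g i) ∧ infoForm lam n (u i) (u i) ≤ ε ∧ ‖u i‖ ≤ ε := by
  obtain ⟨n, hn⟩ := exists_infoForm_coercive hmem horth ε⁻¹
  have hsymm : (infoForm lam n).IsSymm :=
    ⟨fun u v => by simp only [infoForm_apply, mul_comm]⟩
  have hnd : (infoForm lam n).Nondegenerate := by
    refine hsymm.isRefl.nondegenerate_iff_separatingLeft.2 fun v hv => ?_
    have h := hn v
    rw [hv v] at h
    have : ‖v‖ ^ 2 ≤ 0 := nonpos_of_mul_nonpos_right h (by positivity)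
    exact norm_eq_zero.1 (pow_eq_zero_iff two_ne_zero |>.1 (le_antisymm this (sq_nonneg _)))
  refine ⟨n, fun i => ((infoForm lam n).toDual hnd).symm (LinearMap.proj i), fun i => ?_⟩
  set u := ((infoForm lam n).toDual hnd).symm (LinearMap.proj i) with hu
  have hdual : ∀ g, infoForm lam n u g = g i := fun g => by
    rw [hu, LinearMap.BilinForm.apply_toDual_symm_apply]
    rfl
  have h1 : u i ≤ ‖u‖ := (le_abs_self _).trans (norm_le_pi_norm u i)
  have h2 : ε⁻¹ * ‖u‖ ^ 2 ≤ ‖u‖ := (hn u).trans ((hdual u).trans_le h1)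
  have h3 : ‖u‖ ≤ ε := by
    by_contra! h
    have h4 : ‖u‖ ^ 2 ≤ ε * ‖u‖ := by
      rwa [inv_mul_le_iff₀ hε] at h2
    nlinarith
  exact ⟨hdual, (hdual u).trans_le (h1.trans h3), h3⟩

end

/-! ### Almost sure convergence from summable variances -/

/-- Random variables with common mean `c` and summable variances converge to `c` almost surely: the
sum of their squared deviations has finite expectation. -/
theorem ae_tendsto_of_variance_le {Ω : Type*} [MeasurableSpace Ω] {μ : Measure Ω}
    [IsProbabilityMeasure μ] {X : ℕ → Ω → ℝ} (hX : ∀ m, MemLp (X m) 2 μ) {c : ℝ}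
    (hmean : ∀ m, ∫ ω, X m ω ∂μ = c) {b : ℕ → ℝ} (hb : Summable b)
    (hvar : ∀ m, variance (X m) μ ≤ b m) :
    ∀ᵐ ω ∂μ, Tendsto (fun m => X m ω) atTop (𝓝 c) := by
  have hmeas : ∀ m, AEMeasurable (fun ω => ENNReal.ofReal ((X m ω - c) ^ 2)) μ := fun m =>
    (((hX m).aestronglyMeasurable.aemeasurable.sub_const c).pow_const 2).ennreal_ofReal
  have hle : ∀ m, ∫⁻ ω, ENNReal.ofReal ((X m ω - c) ^ 2) ∂μ ≤ ENNReal.ofReal (b m) := fun m => by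
    have := (hX m).ofReal_variance_eq
    rw [evariance_eq_lintegral_ofReal, hmean] at this
    exact this ▸ ENNReal.ofReal_le_ofReal (hvar m)
  have hb0 : ∀ m, 0 ≤ b m := fun m => (variance_nonneg _ _).trans (hvar m)
  have hfin : ∫⁻ ω, ∑' m, ENNReal.ofReal ((X m ω - c) ^ 2) ∂μ ≠ ∞ := by
    rw [lintegral_tsum hmeas]
    refine ne_top_of_le_ne_top ?_ (ENNReal.tsum_le_tsum hle)
    rw [← ENNReal.ofReal_tsum_of_nonneg hb0 hb]
    exact ENNReal.ofReal_ne_top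
  filter_upwards [ae_lt_top' (AEMeasurable.tsum hmeas) hfin] with ω hω
  have h0 := ENNReal.tendsto_atTop_zero_of_tsum_ne_top hω.ne
  have h1 : Tendsto (fun m => (X m ω - c) ^ 2) atTop (𝓝 0) := by
    simpa [Function.comp_def, ENNReal.toReal_ofReal (sq_nonneg _)] using
      (ENNReal.tendsto_toReal ENNReal.zero_ne_top).comp h0
  have h2 : Tendsto (fun m => X m ω - c) atTop (𝓝 0) := by
    rw [tendsto_zero_iff_abs_tendsto_zero]
    simpa [Real.sqrt_sq_eq_abs, Function.comp_def] using h1.sqrt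
  simpa using h2.add_const c

/-! ### Linear estimators -/

/-- The score `β_{jl}(u) / w_{jl}` in the direction `u` of the outcome `l` of the `j`-th variable. -/
noncomputable def score (lam : Fin K → ParamSpace L) (u : Fin K → ℝ) (j : ℕ) (l : Fin (L j)) : ℝ :=
  mixParam lam u j l / weight lam j l

/-- The linear statistic `∑_{j < n} β_{j a_j}(u) / w_{j a_j}` of the first `n` coordinates. -/
noncomputable def estimator (lam : Fin K → ParamSpace L) (n : ℕ) (u : Fin K → ℝ)
    (a : Outcome L) : ℝ :=
  ∑ j ∈ Finset.range n, score lam u j (a j)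

theorem measurable_score_coord (lam : Fin K → ParamSpace L) (u : Fin K → ℝ) (j : ℕ) :
    Measurable fun a : Outcome L => score lam u j (a j) :=
  (measurable_of_finite (score lam u j)).comp (measurable_pi_apply j)

section

variable {lam : Fin K → ParamSpace L} (hmem : ∀ k, lam k ∈ paramBody L)
include hmem

theorem memLp_score {g : Fin K → ℝ} (hg : g ∈ paramSet lam) (u : Fin K → ℝ) (j : ℕ) (p : ℝ≥0∞) :
    MemLp (fun a : Outcome L => score lam u j (a j)) p (indepLaw (mixParam lam g)) := by
  have := isProbabilityMeasure_indepLaw hg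
  exact MemLp.of_bound (measurable_score_coord lam u j).aestronglyMeasurable ‖u‖
    (ae_of_all _ fun a => abs_mixParam_div_weight_le hmem u j (a j))

theorem memLp_estimator {g : Fin K → ℝ} (hg : g ∈ paramSet lam) (n : ℕ) (u : Fin K → ℝ) :
    MemLp (estimator lam n u) 2 (indepLaw (mixParam lam g)) :=
  memLp_finsetSum _ fun j _ => memLp_score hmem hg u j 2

theorem integral_estimator {g : Fin K → ℝ} (hg : g ∈ paramSet lam) (n : ℕ) (u : Fin K → ℝ) :
    ∫ a, estimator lam n u a ∂indepLaw (mixParam lam g) = infoForm lam n u g := by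
  simp only [estimator]
  rw [integral_finsetSum _ fun j _ => memLp_one_iff_integrable.1 (memLp_score hmem hg u j 1),
    infoForm_apply]
  refine Finset.sum_congr rfl fun j _ => ?_
  rw [integral_indepLaw_coord hg j (score lam u j)]
  refine Finset.sum_congr rfl fun l _ => ?_
  rw [score]
  ring

/-- The variance bound holds for all parameters at once, with one information form, because
`β_{jl}(g) ≤ ‖g‖ w_{jl}`. -/
theorem variance_estimator_le {g : Fin K → ℝ} (hg : g ∈ paramSet lam) (n : ℕ) (u : Fin K → ℝ) :
    variance (estimator lam n u) (indepLaw (mixParam lam g)) ≤ ‖g‖ * infoForm lam n u u := by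
  have := isProbabilityMeasure_coordLaw hg
  have := isProbabilityMeasure_indepLaw hg
  have hind : iIndepFun (fun j (a : Outcome L) => score lam u j (a j))
      (indepLaw (mixParam lam g)) :=
    iIndepFun_infinitePi fun j => measurable_of_finite (score lam u j)
  have heq : estimator lam n u =
      ∑ j ∈ Finset.range n, fun a : Outcome L => score lam u j (a j) := by
    ext a
    simp [estimator]
  rw [heq, IndepFun.variance_sum (fun j _ => memLp_score hmem hg u j 2)
    (fun i _ j _ hij => hind.indepFun hij), infoForm_self, Finset.mul_sum]
  refine Finset.sum_le_sum fun j _ => ?_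
  refine (variance_le_expectation_sq
    (measurable_score_coord lam u j).aestronglyMeasurable).trans ?_
  simp only [Pi.pow_apply]
  rw [integral_indepLaw_coord hg j (fun l => score lam u j l ^ 2), Finset.mul_sum]
  refine Finset.sum_le_sum fun l _ => ?_
  rcases eq_or_ne (weight lam j l) 0 with h0 | h0
  · simp [score, h0]
  · calc mixParam lam g j l * score lam u j l ^ 2
        ≤ (‖g‖ * weight lam j l) * score lam u j l ^ 2 := by
          gcongr
          exact (le_abs_self _).trans (abs_mixParam_le hmem g j l)
      _ = ‖g‖ * (mixParam lam u j l ^ 2 / weight lam j l) := by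
          rw [score]
          field_simp

theorem abs_estimator_sub_tail_le (n N : ℕ) (u : Fin K → ℝ) (a : Outcome L) :
    |estimator lam n u a - ∑ j ∈ (Finset.range n).filter (N ≤ ·), score lam u j (a j)| ≤
      N * ‖u‖ := by
  rw [estimator, ← Finset.sum_filter_add_sum_filter_not (Finset.range n) (N ≤ ·),
    add_sub_cancel_left]
  refine (Finset.abs_sum_le_sum_abs _ _).trans ((Finset.sum_le_card_nsmul _ _ ‖u‖
    fun j _ => abs_mixParam_div_weight_le hmem u j (a j)).trans ?_)
  rw [nsmul_eq_mul]
  refine mul_le_mul_of_nonneg_right ?_ (norm_nonneg u)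
  have : (Finset.range n).filter (fun j => ¬ N ≤ j) ⊆ Finset.range N := fun j hj => by
    simpa using (Finset.mem_filter.1 hj).2
  exact_mod_cast (Finset.card_le_card this).trans_eq (Finset.card_range N)

/-- When the vectors `u_m` tend to zero, the first `N` coordinates do not affect the limit of the
estimators. -/
theorem measurableSet_tailSigma_tendsto_estimator {n : ℕ → ℕ} {u : ℕ → Fin K → ℝ}
    (hu : Tendsto (fun m => ‖u m‖) atTop (𝓝 0)) (c : ℝ) :
    MeasurableSet[tailSigma L] {a | Tendsto (fun m => estimator lam (n m) (u m) a) atTop (𝓝 c)} := by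
  rw [tailSigma, MeasurableSpace.measurableSet_iInf]
  intro N
  have hset : {a : Outcome L | Tendsto (fun m => estimator lam (n m) (u m) a) atTop (𝓝 c)} =
      {a | Tendsto (fun m => ∑ j ∈ (Finset.range (n m)).filter (N ≤ ·), score lam (u m) j (a j))
        atTop (𝓝 c)} := by
    ext a
    have hd : Tendsto (fun m => estimator lam (n m) (u m) a -
        ∑ j ∈ (Finset.range (n m)).filter (N ≤ ·), score lam (u m) j (a j)) atTop (𝓝 0) :=
      squeeze_zero_norm (fun m => abs_estimator_sub_tail_le hmem (n m) N (u m) a)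
        (by simpa using hu.const_mul (N : ℝ))
    exact ⟨fun h => by simpa using Tendsto.sub h hd, fun h => by simpa using Tendsto.add h hd⟩
  rw [hset]
  -- The `σ`-algebra is `futureSigma L N`, not the product one found by instance search.
  refine @measurableSet_tendsto _ _ _ (futureSigma L N) _ _ _ _ _ _ _ _ fun m => ?_
  refine @Finset.measurable_sum _ _ _ _ _ _ (futureSigma L N) _ _ fun j hj => ?_
  have hcoord : Measurable[futureSigma L N] fun a : Outcome L => a j :=
    Measurable.mono (comap_measurable _)
      (le_iSup₂_of_le j (Finset.mem_filter.1 hj).2 le_rfl) le_rfl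
  exact (measurable_of_finite (score lam (u m) j)).comp hcoord

/-- The tail events separating the laws `P_g`, simultaneously for all parameters `g`. -/
theorem exists_tailSigma_disjoint_supports
    (horth : ∀ g g' : paramSet lam, g ≠ g' → (law lam g).MutuallySingular (law lam g')) :
    ∃ A : paramSet lam → Set (Outcome L), (∀ g, MeasurableSet[tailSigma L] (A g)) ∧
      (∀ g, law lam g (A g) = 1) ∧ ∀ g g', g ≠ g' → Disjoint (A g) (A g') := by
  have hpos : ∀ m : ℕ, (0 : ℝ) < (1 / 2) ^ m := fun m => by positivity
  choose n u hu using fun m => exists_small_dual_vectors hmem horth (hpos m)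
  have hgeom : Summable fun m : ℕ => (1 / 2 : ℝ) ^ m := summable_geometric_two
  refine ⟨fun g => ⋂ i, {a |
    Tendsto (fun m => estimator lam (n m) (u m i) a) atTop (𝓝 (g.1 i))}, fun g => ?_,
    fun g => ?_, fun g g' hne => ?_⟩
  · refine MeasurableSet.iInter fun i => measurableSet_tailSigma_tendsto_estimator hmem ?_ _
    exact squeeze_zero (fun m => norm_nonneg _) (fun m => (hu m i).2.2)
      hgeom.tendsto_atTop_zero
  · have hg : g.1 ∈ paramSet lam := g.2
    have := isProbabilityMeasure_indepLaw hg
    refine (measure_congr (eventuallyEq_univ.2 (countable_iInter_mem.2 fun i => ?_))).trans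
      (measure_univ (μ := indepLaw (mixParam lam g.1)))
    refine ae_tendsto_of_variance_le (fun m => memLp_estimator hmem hg (n m) (u m i))
      (fun m => ?_) (hgeom.mul_left ‖g.1‖) fun m => ?_
    · rw [integral_estimator hmem hg, (hu m i).1]
    · exact (variance_estimator_le hmem hg _ _).trans
        (mul_le_mul_of_nonneg_left (hu m i).2.1 (norm_nonneg _))
  · refine Set.disjoint_left.2 fun a ha ha' => hne (Subtype.ext (funext fun i => ?_))
    exact tendsto_nhds_unique (Set.mem_iInter.1 ha i) (Set.mem_iInter.1 ha' i)

end

end IndepMixture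

theorem mainTheorem2 (L : ℕ → ℕ) (K : ℕ) (lam : Fin K → IndepMixture.ParamSpace L)
    (hmem : ∀ k, lam k ∈ IndepMixture.paramBody L) (hlin : LinearIndependent ℝ lam)
    (horth : ∀ g g' : IndepMixture.paramSet lam, g ≠ g' →
      (IndepMixture.law lam g).MutuallySingular (IndepMixture.law lam g'))
    (μ : MeasureTheory.Measure (IndepMixture.paramSet lam))
    [MeasureTheory.IsProbabilityMeasure μ] :
    ∃ Q₁ : Set (IndepMixture.paramSet lam), MeasurableSet Q₁ ∧ μ Q₁ = 1 ∧
      ∃ A : Q₁ → Set (IndepMixture.Outcome L),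
        (∀ g : Q₁, MeasurableSet[IndepMixture.tailSigma L] (A g)) ∧
        (∀ g : Q₁, IndepMixture.law lam (g : IndepMixture.paramSet lam) (A g) = 1) ∧
        ∀ g g' : Q₁, g ≠ g' → Disjoint (A g) (A g') := by
  obtain ⟨A, hmeas, hone, hdisj⟩ := IndepMixture.exists_tailSigma_disjoint_supports hmem horth
  exact ⟨Set.univ, .univ, measure_univ, fun g => A g, fun g => hmeas g, fun g => hone g,
    fun g g' hne => hdisj g g' fun h => hne (Subtype.ext h)⟩
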